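/- Let $\mathbb{A}^{\sim}=\mathbb{R}\times[0,1]$ be the closed band, let $T(\theta,t)=(\theta+1,t)$, and let $p_1(\theta,t)=\theta$. For a homeomorphism $\Phi$ of $\mathbb{A}^{\sim}$ commuting with $T$, its rotation set $\mathrm{Rot}(\Phi)$ is the set of all real numbers $v$ for which there are integers $n_k\to+\infty$ and points $x_k\in\mathbb{A}^{\sim}$ with $$\frac{p_1(\Phi^{n_k}(x_k))-p_1(x_k)}{n_k}\longrightarrow v .$$ An essential simple arc in $\mathbb{A}^{\sim}$ is (the image of) a continuous injective map $\gamma:[0,1]\to\mathbb{A}^{\sim}$ such that $\gamma(0)$ and $\gamma(1)$ lie on different boundary components of $\mathbb{A}^{\sim}$ and $\gamma(]0,1[)\subset\mathbb{R}\times\,]0,1[$. Let $\Phi_1,\Phi_2$ be two homeomorphisms of $\mathbb{A}^{\sim}$, each isotopic to the identity (through homeomorphisms of $\mathbb{A}^{\sim}$), which commute with each other and with $T$, and such that $\mathrm{Rot}(\Phi_1)\subset\,]0,+\infty[$ and $\mathrm{Rot}(\Phi_2)\subset\,]0,+\infty[$. Then there exists an essential simple arc $\Gamma$ in $\mathbb{A}^{\sim}$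 such that $\Gamma\cap\Phi_1(\Gamma)=\emptyset$ and $\Gamma\cap\Phi_2(\Gamma)=\emptyset$. -/

import Mathlib

open Filter Topology

/-- The closed band `ℝ × [0,1]`, the universal cover of the closed annulus. -/
abbrev Band : Type := ℝ × unitInterval

namespace Band

/-- The translation `T (θ, t) = (θ + 1, t)`. -/
def T (x : Band) : Band := (x.1 + 1, x.2)

/-- `Φ` is isotopic to the identity: it is joined to the identity by a path of homeomorphisms
of the band that is jointly continuous in time and space. -/
def IsotopicToId (Φ : Band ≃ₜ Band) : Prop :=
  ∃ F : unitInterval → (Band ≃ₜ Band),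
    Continuous (fun p : unitInterval × Band => F p.1 p.2) ∧
      F 0 = Homeomorph.refl Band ∧ F 1 = Φ

/-- The `n`-th displacement set (only `n ≥ 1` is meaningful):
all mean horizontal displacements over `n` iterates. -/
def displacementSet (Φ : Band → Band) (n : ℕ) : Set ℝ :=
  {v | ∃ x : Band, v = ((Φ^[n] x).1 - x.1) / (n : ℝ)}

/-- The rotation set: all real limits of sequences `v k ∈ D_{n k}` with `n k → ∞`. -/
def rotationSet (Φ : Band → Band) : Set ℝ :=
  {r | ∃ (n : ℕ → ℕ) (v : ℕ → ℝ), Tendsto n atTop atTop ∧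
    (∀ k, v k ∈ displacementSet Φ (n k)) ∧ Tendsto v atTop (𝓝 r)}

/-- An essential simple arc: a simple arc joining one boundary component of the band to the
other one, and whose relative interior lies in the interior of the band. -/
structure IsEssentialSimpleArc (γ : unitInterval → Band) : Prop where
  continuous : Continuous γ
  injective : Function.Injective γ
  endpoints : ((γ 0).2 = 0 ∧ (γ 1).2 = 1) ∨ ((γ 0).2 = 1 ∧ (γ 1).2 = 0)
  interior : ∀ s : unitInterval, 0 < s → s < 1 → 0 < (γ s).2 ∧ (γ s).2 < 1

end Band

/-!
Only the average of the horizontal coordinate along both maps is needed, and then plane topology.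

Since the rotation sets are positive, compactness gives `N, M ≥ 1` such that `Φ₁^N` and `Φ₂^M` move
every point strictly to the right (`Band.exists_iterate_gt`). Let `h` be the sum of
`p₁ (Φ₂^j (Φ₁^i x))` over `i < N`, `j < M`. Since the maps commute, telescoping in `i` or in `j`
shows that `h` strictly increases along `Φ₁` and along `Φ₂`; as the increments are invariant under
`T`, they are bounded below by some `δ > 0` (`Band.exists_lyapunov`). Hence an arc contained in
`{|h| < δ / 2}` is disjoint from both its images, which lie in `{h > δ / 2}`.

As `h` stays at bounded distance from a positive multiple of the horizontal coordinate, it remains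
to find an essential simple arc near the level set `{h = 0}`. Extend `h` to the plane by clamping
the height. If no arc in the open set `V = {|h| < ε}` joined `{t ≤ 0}` to `{t ≥ 1}`, the points of
`V` reachable by arcs from `{t ≤ 0}` would form a relatively clopen subset of `V`
(`ArcJoined.of_closedBall`). Urysohn's lemma would then give a function `g`, nonzero on `{h = 0}`,
negative below and positive above the band, which contradicts the Poincaré–Miranda theorem for
`(h, g)` (`exists_common_zero`). That theorem is proved by following a continuous argument of
`h + i g` around a rectangle. Finally the arc is cut between its last visit to `{t ≤ 0}` and its
next visit to `{t ≥ 1}`.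
-/

/-! ### The Poincaré–Miranda theorem in the plane -/

/-- If `cos (φ - c)` is positive on a connected set, then `φ` stays there within `π / 2` of a single
determination of the angle `c`. -/
theorem exists_int_abs_sub_lt_of_cos_pos {X : Type*} [TopologicalSpace X] {φ : X → ℝ}
    (hφ : Continuous φ) {S : Set X} (hS : IsPreconnected S) (c : ℝ)
    (hpos : ∀ x ∈ S, 0 < Real.cos (φ x - c)) :
    ∃ k : ℤ, ∀ x ∈ S, |φ x - c - k * (2 * Real.pi)| < Real.pi / 2 := by
  rcases S.eq_empty_or_nonempty with rfl | ⟨x₀, hx₀⟩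
  · exact ⟨0, by simp⟩
  have hpi := Real.pi_pos
  have hcos : ∀ (k : ℤ) (x : X), Real.cos (φ x - c - k * (2 * Real.pi)) = Real.cos (φ x - c) :=
    fun k x => Real.cos_sub_int_mul_two_pi _ _
  have hne : ∀ (k : ℤ), ∀ x ∈ S, |φ x - c - k * (2 * Real.pi)| ≠ Real.pi / 2 := by
    intro k x hx h
    have h1 := hpos x hx
    rw [← hcos k, ← Real.cos_abs, h, Real.cos_pi_div_two] at h1
    exact lt_irrefl _ h1
  refine ⟨round ((φ x₀ - c) / (2 * Real.pi)), fun x hx => ?_⟩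
  set k := round ((φ x₀ - c) / (2 * Real.pi))
  have h0 : |φ x₀ - c - k * (2 * Real.pi)| < Real.pi / 2 := by
    by_contra! hcon
    have h1 : |φ x₀ - c - k * (2 * Real.pi)| ≤ Real.pi := by
      have h2 := abs_sub_round ((φ x₀ - c) / (2 * Real.pi))
      have h3 : φ x₀ - c - k * (2 * Real.pi)
          = ((φ x₀ - c) / (2 * Real.pi) - k) * (2 * Real.pi) := by
        field_simp
      rw [h3, abs_mul, abs_of_pos (by positivity : (0 : ℝ) < 2 * Real.pi)]
      nlinarith
    have h4 := Real.cos_nonpos_of_pi_div_two_le_of_le hcon (by linarith)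
    rw [Real.cos_abs, hcos] at h4
    exact absurd (hpos x₀ hx₀) (not_lt.mpr h4)
  by_contra! hcon
  have hc : ContinuousOn (fun y => |φ y - c - k * (2 * Real.pi)|) S := by fun_prop
  obtain ⟨y, hy, hy'⟩ := hS.intermediate_value hx₀ hx hc ⟨h0.le, hcon⟩
  exact hne k y hy hy'

/-- The **Poincaré–Miranda theorem**, for functions on the plane with prescribed signs on four
half-planes. -/
theorem exists_common_zero {f g : ℝ × ℝ → ℝ} (hf : Continuous f) (hg : Continuous g) {a b c d : ℝ}
    (hfa : ∀ x : ℝ × ℝ, x.1 ≤ a → f x < 0) (hfb : ∀ x : ℝ × ℝ, b ≤ x.1 → 0 < f x)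
    (hgc : ∀ x : ℝ × ℝ, x.2 ≤ c → g x < 0) (hgd : ∀ x : ℝ × ℝ, d ≤ x.2 → 0 < g x) :
    ∃ x, f x = 0 ∧ g x = 0 := by
  by_contra! hne
  let F : C(ℝ × ℝ, ℂ) := ⟨fun x => f x + g x * Complex.I, by fun_prop⟩
  have hre : ∀ x, (F x).re = f x := by simp [F]
  have him : ∀ x, (F x).im = g x := by simp [F]
  have hF : ∀ x, F x ∈ ({0}ᶜ : Set ℂ) := by
    intro x hx
    have hx : F x = 0 := hx
    exact hne x (by rw [← hre, hx]; rfl) (by rw [← him, hx]; rfl)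
  obtain ⟨L, ⟨-, hL⟩, -⟩ := Complex.isCoveringMapOn_exp.existsUnique_continuousMap_lifts F
    (a₀ := ((0 : ℝ), (0 : ℝ))) (Complex.exp_log (hF _)) hF
  set φ : ℝ × ℝ → ℝ := fun x => (L x).im
  have hφ : Continuous φ := Complex.continuous_im.comp L.continuous
  have hfφ : ∀ x, f x = Real.exp (L x).re * Real.cos (φ x) := by
    intro x
    rw [← hre, ← congrFun hL x]
    exact Complex.exp_re _
  have hgφ : ∀ x, g x = Real.exp (L x).re * Real.sin (φ x) := by
    intro x
    rw [← him, ← congrFun hL x]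
    exact Complex.exp_im _
  have hE : ∀ x, 0 < Real.exp (L x).re := fun x => Real.exp_pos _
  -- On the four half-planes the argument is close to `0`, `π / 2`, `π`, `3π / 2` respectively.
  obtain ⟨k₁, h₁⟩ := exists_int_abs_sub_lt_of_cos_pos hφ (S := {x : ℝ × ℝ | b ≤ x.1})
    ((convex_Ici b).linear_preimage (LinearMap.fst ℝ ℝ ℝ)).isPreconnected 0 (by
      intro x hx
      have := hfb x hx
      rw [hfφ] at this
      simpa using pos_of_mul_pos_right this (hE x).le)
  obtain ⟨k₂, h₂⟩ := exists_int_abs_sub_lt_of_cos_pos hφ (S := {x : ℝ × ℝ | d ≤ x.2})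
    ((convex_Ici d).linear_preimage (LinearMap.snd ℝ ℝ ℝ)).isPreconnected (Real.pi / 2) (by
      intro x hx
      have := hgd x hx
      rw [hgφ] at this
      rw [Real.cos_sub_pi_div_two]
      exact pos_of_mul_pos_right this (hE x).le)
  obtain ⟨k₃, h₃⟩ := exists_int_abs_sub_lt_of_cos_pos hφ (S := {x : ℝ × ℝ | x.1 ≤ a})
    ((convex_Iic a).linear_preimage (LinearMap.fst ℝ ℝ ℝ)).isPreconnected Real.pi (by
      intro x hx
      have := hfa x hx
      rw [hfφ] at this
      rw [Real.cos_sub_pi]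
      nlinarith [hE x])
  obtain ⟨k₄, h₄⟩ := exists_int_abs_sub_lt_of_cos_pos hφ (S := {x : ℝ × ℝ | x.2 ≤ c})
    ((convex_Iic c).linear_preimage (LinearMap.snd ℝ ℝ ℝ)).isPreconnected
    (Real.pi + Real.pi / 2) (by
      intro x hx
      have := hgc x hx
      rw [hgφ] at this
      rw [← sub_sub, Real.cos_sub_pi_div_two, Real.sin_sub_pi]
      nlinarith [hE x])
  have hpi := Real.pi_pos
  -- Two consecutive half-planes meet, so the same determination is used on both.
  have corner : ∀ {u v : ℤ} {z c c' : ℝ}, |z - c - u * (2 * Real.pi)| < Real.pi / 2 →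
      |z - c' - v * (2 * Real.pi)| < Real.pi / 2 → c' = c + Real.pi / 2 → v = u := by
    rintro u v z c _ hu hv rfl
    rw [abs_lt] at hu hv
    have h1 : (v : ℝ) < u + 1 := by
      by_contra! hcon
      nlinarith
    have h2 : (u : ℝ) < v + 1 := by
      by_contra! hcon
      nlinarith
    norm_cast at h1 h2
    omega
  have e₂ : k₂ = k₁ := corner (h₁ (b, d) (le_refl b)) (h₂ (b, d) (le_refl d)) (by ring)
  have e₃ : k₃ = k₂ := corner (h₂ (a, d) (le_refl d)) (h₃ (a, d) (le_refl a)) (by ring)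
  have e₄ : k₄ = k₃ := corner (h₃ (a, c) (le_refl a)) (h₄ (a, c) (le_refl c)) (by ring)
  -- At the last corner a full turn has been made.
  have e₁ : k₁ - 1 = k₄ := corner (h₄ (b, c) (le_refl c))
    (c' := 2 * Real.pi) (v := k₁ - 1) (by
      have := h₁ (b, c) (le_refl b)
      push_cast
      convert this using 2
      ring) (by ring)
  omega

/-! ### Arcs in open sets -/

/-- `p` and `q` are joined by a simple arc in `V`. The arc is parametrized by an interval `[0, b]`
of arbitrary length, and the degenerate arc `b = 0` is allowed, so that the relation is reflexive
on `V`. -/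
def ArcJoined {E : Type*} [TopologicalSpace E] (V : Set E) (p q : E) : Prop :=
  ∃ (b : ℝ) (γ : ℝ → E), 0 ≤ b ∧ ContinuousOn γ (Set.Icc 0 b) ∧ Set.InjOn γ (Set.Icc 0 b) ∧
    Set.MapsTo γ (Set.Icc 0 b) V ∧ γ 0 = p ∧ γ b = q

theorem ArcJoined.refl {E : Type*} [TopologicalSpace E] {V : Set E} {p : E} (hp : p ∈ V) :
    ArcJoined V p p :=
  ⟨0, fun _ => p, le_rfl, continuousOn_const, by simp, fun _ _ => hp, rfl, rfl⟩

theorem ArcJoined.mem_right {E : Type*} [TopologicalSpace E] {V : Set E} {p q : E}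
    (h : ArcJoined V p q) : q ∈ V := by
  obtain ⟨b, γ, hb, -, -, hγ, -, rfl⟩ := h
  exact hγ ⟨hb, le_rfl⟩

/-- An arc ending in a closed ball contained in `V` can be redirected to any other point of the
ball: stop it when it first meets the ball and continue along a segment. -/
theorem ArcJoined.of_closedBall {E : Type*} [NormedAddCommGroup E] [NormedSpace ℝ E] {V : Set E}
    {p x y z : E} {r : ℝ} (h : ArcJoined V p x) (hV : Metric.closedBall z r ⊆ V)
    (hx : x ∈ Metric.closedBall z r) (hy : y ∈ Metric.closedBall z r) : ArcJoined V p y := by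
  obtain ⟨b, γ, hb, hc, hi, hm, rfl, rfl⟩ := h
  have hK : IsCompact (Set.Icc 0 b ∩ γ ⁻¹' Metric.closedBall z r) :=
    isCompact_Icc.of_isClosed_subset
      (hc.preimage_isClosed_of_isClosed isClosed_Icc Metric.isClosed_closedBall)
      Set.inter_subset_left
  obtain ⟨s, ⟨hs, hsB⟩, hmin⟩ := hK.exists_isLeast ⟨b, ⟨hb, le_rfl⟩, hx⟩
  have hsub : Set.Icc 0 s ⊆ Set.Icc 0 b := Set.Icc_subset_Icc_right hs.2
  have hfirst : ∀ t, 0 ≤ t → t < s → γ t ∉ Metric.closedBall z r := fun t ht hts hmem =>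
    absurd (hmin ⟨⟨ht, hts.le.trans hs.2⟩, hmem⟩) (not_le.mpr hts)
  by_cases hne : γ s = y
  · exact ⟨s, γ, hs.1, hc.mono hsub, hi.mono hsub, hm.mono_left hsub, rfl, hne⟩
  have hseg : ∀ t, s ≤ t → t ≤ s + 1 →
      AffineMap.lineMap (γ s) y (t - s) ∈ Metric.closedBall z r := fun t h1 h2 =>
    (convex_closedBall z r).lineMap_mem hsB hy ⟨by linarith, by linarith⟩
  refine ⟨s + 1, fun t => if t ≤ s then γ t else AffineMap.lineMap (γ s) y (t - s),
    by linarith [hs.1], ?_, ?_, ?_, by simp [hs.1], by simp⟩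
  · refine ContinuousOn.if ?_ ?_ ?_
    · rintro t ⟨-, ht⟩
      have : t = s := by simpa using frontier_le_subset_eq continuous_id continuous_const ht
      simp [this]
    · refine hc.mono ?_
      rintro t ⟨ht, ht'⟩
      have : t ≤ s := by
        have := closure_minimal (s := {t : ℝ | t ≤ s}) subset_rfl isClosed_Iic ht'
        exact this
      exact hsub ⟨ht.1, this⟩
    · exact (AffineMap.lineMap_continuous.comp (by fun_prop)).continuousOn
  · intro t ht u hu htu
    wlog hle : t ≤ u generalizing t u
    · exact (this hu ht htu.symm (not_le.mp hle).le).symm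
    by_cases hus : u ≤ s
    · have hts := hle.trans hus
      simp only [hus, hts, if_true] at htu
      exact hi (hsub ⟨ht.1, hts⟩) (hsub ⟨hu.1, hus⟩) htu
    have hus' := not_le.mp hus
    by_cases hts : t ≤ s
    · simp only [hus, hts, if_true, if_false] at htu
      rcases hts.lt_or_eq with hts | rfl
      · exact absurd (htu ▸ hseg u hus'.le hu.2) (hfirst t ht.1 hts)
      · rw [eq_comm, AffineMap.lineMap_eq_left_iff] at htu
        rcases htu with h | h
        · exact absurd h hne
        · linarith
    · simp only [hus, hts, if_false] at htu
      have := AffineMap.lineMap_injective ℝ hne htu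
      linarith
  · intro t ht
    by_cases hts : t ≤ s
    · simp only [hts, if_true]
      exact hm (hsub ⟨ht.1, hts⟩)
    · simp only [hts, if_false]
      exact hV (hseg t (not_le.mp hts).le ht.2)

/-! ### Crossing the plane near a level set -/

/-- If `f` is negative far to the left and positive far to the right, then the open set
`{|f| < ε}` contains a simple arc from `{t ≤ 0}` to `{t ≥ 1}`. -/
theorem exists_arcJoined_abs_lt {f : ℝ × ℝ → ℝ} (hf : Continuous f) {a b ε : ℝ} (hε : 0 < ε)
    (hfa : ∀ x : ℝ × ℝ, x.1 ≤ a → f x < 0) (hfb : ∀ x : ℝ × ℝ, b ≤ x.1 → 0 < f x) :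
    ∃ p q : ℝ × ℝ, p.2 ≤ 0 ∧ 1 ≤ q.2 ∧ ArcJoined {x | |f x| < ε} p q := by
  by_contra! hcon
  set V : Set (ℝ × ℝ) := {x | |f x| < ε}
  have hV : IsOpen V := isOpen_lt (by fun_prop) continuous_const
  have hball : ∀ x ∈ V, ∃ r > 0, Metric.closedBall x r ⊆ V := fun x hx =>
    Metric.nhds_basis_closedBall.mem_iff.mp (hV.mem_nhds hx)
  set W : Set (ℝ × ℝ) := {x | ∃ p : ℝ × ℝ, p.2 ≤ 0 ∧ ArcJoined V p x}
  have hW : IsOpen W := by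
    rw [isOpen_iff_mem_nhds]
    rintro x ⟨p, hp, hpx⟩
    obtain ⟨r, hr, hrV⟩ := hball x hpx.mem_right
    refine Filter.mem_of_superset (Metric.closedBall_mem_nhds x hr) fun y hy => ⟨p, hp, ?_⟩
    exact hpx.of_closedBall hrV (Metric.mem_closedBall_self hr.le) hy
  have hW' : IsOpen (V \ W) := by
    rw [isOpen_iff_mem_nhds]
    rintro x ⟨hx, hxW⟩
    obtain ⟨r, hr, hrV⟩ := hball x hx
    refine Filter.mem_of_superset (Metric.closedBall_mem_nhds x hr) fun y hy => ⟨hrV hy, ?_⟩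
    rintro ⟨p, hp, hpy⟩
    exact hxW ⟨p, hp, hpy.of_closedBall hrV hy (Metric.mem_closedBall_self hr.le)⟩
  have hZV : {x | f x = 0} ⊆ V := by
    intro x hx
    have hx : f x = 0 := hx
    simpa [V, hx] using hε
  have hZ : IsClosed {x | f x = 0} := isClosed_eq hf continuous_const
  have hC₁ : IsClosed (({x | f x = 0} \ (V \ W)) ∪ {x | x.2 ≤ 0}) :=
    (hZ.sdiff hW').union (isClosed_le (by fun_prop) continuous_const)
  have hC₂ : IsClosed (({x | f x = 0} \ W) ∪ {x | 1 ≤ x.2}) :=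
    (hZ.sdiff hW).union (isClosed_le continuous_const (by fun_prop))
  have hdisj : Disjoint (({x | f x = 0} \ (V \ W)) ∪ {x | x.2 ≤ 0})
      (({x | f x = 0} \ W) ∪ {x | 1 ≤ x.2}) := by
    rw [Set.disjoint_left]
    rintro x (⟨hx, hxW⟩ | hx) (⟨hx', hxW'⟩ | hx')
    · exact hxW ⟨hZV hx, hxW'⟩
    · have : x ∈ W := by
        by_contra h
        exact hxW ⟨hZV hx, h⟩
      obtain ⟨p, hp, hpx⟩ := this
      exact hcon p x hp hx' hpx
    · exact hxW' ⟨x, hx, ArcJoined.refl (hZV hx')⟩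
    · simp only [Set.mem_ofPred_eq] at hx hx'
      linarith
  obtain ⟨u, hu₁, hu₂, -⟩ := exists_continuous_zero_one_of_isClosed hC₁ hC₂ hdisj
  obtain ⟨x, hx, hx'⟩ := exists_common_zero hf (g := fun x => 2 * u x - 1) (by fun_prop)
    (c := 0) (d := 1) hfa hfb
    (fun x hx => by
      have : u x = 0 := hu₁ (Or.inr hx)
      norm_num [this])
    (fun x hx => by
      have : u x = 1 := hu₂ (Or.inr hx)
      norm_num [this])
  by_cases hxW : x ∈ W
  · have : u x = 0 := hu₁ (Or.inl ⟨hx, fun h => h.2 hxW⟩)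
    norm_num [this] at hx'
  · have : u x = 1 := hu₂ (Or.inl ⟨hx, hxW⟩)
    norm_num [this] at hx'

namespace Band

/-- A simple arc of the plane crossing the band contains an essential simple arc of the band. -/
theorem exists_isEssentialSimpleArc_of_arcJoined {V : Set (ℝ × ℝ)} {p q : ℝ × ℝ}
    (h : ArcJoined V p q) (hp : p.2 ≤ 0) (hq : 1 ≤ q.2) :
    ∃ γ : unitInterval → Band, IsEssentialSimpleArc γ ∧
      ∀ s, ((γ s).1, ((γ s).2 : ℝ)) ∈ V := by
  obtain ⟨b, γ, hb, hc, hi, hm, rfl, rfl⟩ := h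
  have hc₂ : ContinuousOn (fun t => (γ t).2) (Set.Icc 0 b) := continuous_snd.comp_continuousOn hc
  -- the last time `u` at height at most `0`
  obtain ⟨u, ⟨hu, hu0⟩, hmax⟩ := (isCompact_Icc.of_isClosed_subset
    (hc₂.preimage_isClosed_of_isClosed isClosed_Icc isClosed_Iic)
    Set.inter_subset_left).exists_isGreatest (⟨0, ⟨le_rfl, hb⟩, hp⟩ :
      (Set.Icc 0 b ∩ (fun t => (γ t).2) ⁻¹' Set.Iic 0).Nonempty)
  have hpos : ∀ t, u < t → t ≤ b → 0 < (γ t).2 := by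
    intro t hut htb
    by_contra! hcon
    exact absurd (hmax ⟨⟨hu.1.trans hut.le, htb⟩, hcon⟩) (not_le.mpr hut)
  have hub : Set.Icc u b ⊆ Set.Icc 0 b := Set.Icc_subset_Icc_left hu.1
  -- the first time `v` after `u` at height at least `1`
  obtain ⟨v, ⟨hv, hv1⟩, hmin⟩ := (isCompact_Icc.of_isClosed_subset
    ((hc₂.mono hub).preimage_isClosed_of_isClosed isClosed_Icc isClosed_Ici)
    Set.inter_subset_left).exists_isLeast (⟨b, ⟨hu.2, le_rfl⟩, hq⟩ :
      (Set.Icc u b ∩ (fun t => (γ t).2) ⁻¹' Set.Ici 1).Nonempty)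
  have hlt : ∀ t, u ≤ t → t < v → (γ t).2 < 1 := by
    intro t hut htv
    by_contra! hcon
    exact absurd (hmin ⟨⟨hut, htv.le.trans hv.2⟩, hcon⟩) (not_le.mpr htv)
  have hu0 : (γ u).2 ≤ 0 := hu0
  have hv1 : 1 ≤ (γ v).2 := hv1
  have huv : u < v := by
    refine lt_of_le_of_ne hv.1 ?_
    rintro rfl
    linarith
  have huv' : Set.Icc u v ⊆ Set.Icc 0 b := Set.Icc_subset_Icc hu.1 hv.2
  have hγu : (γ u).2 = 0 := by
    obtain ⟨w, hw, hw0⟩ := intermediate_value_Icc huv.le (hc₂.mono huv') ⟨hu0, by linarith⟩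
    rcases hw.1.lt_or_eq with h | rfl
    · exact absurd hw0 (hpos w h (huv' hw).2).ne'
    · exact hw0
  have hγv : (γ v).2 = 1 := by
    obtain ⟨w, hw, hw0⟩ := intermediate_value_Icc huv.le (hc₂.mono huv') ⟨by linarith, hv1⟩
    rcases hw.2.lt_or_eq with h | rfl
    · exact absurd hw0 (hlt w hw.1 h).ne
    · exact hw0
  have hrange : ∀ t ∈ Set.Icc u v, (γ t).2 ∈ unitInterval := by
    intro t ht
    constructor
    · rcases ht.1.lt_or_eq with h | rfl
      · exact (hpos t h (huv' ht).2).le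
      · exact hγu.ge
    · rcases ht.2.lt_or_eq with h | rfl
      · exact (hlt t ht.1 h).le
      · exact hγv.le
  let τ : unitInterval → ℝ := fun s => u + s * (v - u)
  have hτ : ∀ s, τ s ∈ Set.Icc u v := fun s =>
    ⟨by nlinarith [s.2.1, sub_pos.mpr huv], by nlinarith [s.2.2, sub_pos.mpr huv]⟩
  have hτc : Continuous τ := by fun_prop
  have hγτ : Continuous fun s => γ (τ s) := hc.comp_continuous hτc fun s => huv' (hτ s)
  refine ⟨fun s => ((γ (τ s)).1, ⟨(γ (τ s)).2, hrange _ (hτ s)⟩),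
    ⟨?_, ?_, Or.inl ⟨?_, ?_⟩, ?_⟩, fun s => hm (huv' (hτ s))⟩
  · exact (continuous_fst.comp hγτ).prodMk ((continuous_snd.comp hγτ).subtype_mk _)
  · intro s t hst
    rw [Prod.mk.injEq, Subtype.mk.injEq] at hst
    have := hi (huv' (hτ s)) (huv' (hτ t)) (Prod.ext hst.1 hst.2)
    have h0 : ((s : ℝ) - t) * (v - u) = 0 := by
      simp only [τ] at this
      linarith
    rcases mul_eq_zero.mp h0 with h | h
    · exact Subtype.ext (sub_eq_zero.mp h)
    · linarith
  · exact Subtype.ext (by simpa [τ] using hγu)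
  · exact Subtype.ext (by simpa [τ] using hγv)
  · intro s hs0 hs1
    have h0 : (0 : ℝ) < s := hs0
    have h1 : (s : ℝ) < 1 := hs1
    have hl : u < τ s := by
      simp only [τ]
      nlinarith [sub_pos.mpr huv]
    have hr : τ s < v := by
      simp only [τ]
      nlinarith [sub_pos.mpr huv]
    exact ⟨hpos _ hl (huv' (hτ s)).2, hlt _ hl.le hr⟩

/-- Every neighbourhood `{|h| < ε}` of a level set of a continuous function on the band that is
negative far to the left and positive far to the right contains an essential simple arc. -/
theorem exists_isEssentialSimpleArc_abs_lt {h : Band → ℝ} (hh : Continuous h) {a b ε : ℝ}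
    (hε : 0 < ε) (ha : ∀ x : Band, x.1 ≤ a → h x < 0) (hb : ∀ x : Band, b ≤ x.1 → 0 < h x) :
    ∃ γ : unitInterval → Band, IsEssentialSimpleArc γ ∧ ∀ s, |h (γ s)| < ε := by
  obtain ⟨p, q, hp, hq, hpq⟩ := exists_arcJoined_abs_lt
    (f := fun x : ℝ × ℝ => h (x.1, Set.projIcc 0 1 zero_le_one x.2)) (a := a) (b := b)
    (hh.comp (continuous_fst.prodMk (continuous_projIcc.comp continuous_snd))) hε
    (fun x hx => ha _ hx) (fun x hx => hb _ hx)
  obtain ⟨γ, hγ, hγV⟩ := exists_isEssentialSimpleArc_of_arcJoined hpq hp hq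
  refine ⟨γ, hγ, fun s => ?_⟩
  have := hγV s
  simpa only [Set.mem_ofPred_eq, Set.projIcc_val] using this

/-! ### Functions invariant under the translation -/

/-- A continuous function invariant under `T` attains its minimum. -/
theorem exists_forall_le_of_T_invariant {f : Band → ℝ} (hf : Continuous f)
    (hT : ∀ x, f (T x) = f x) : ∃ y, ∀ x, f y ≤ f x := by
  obtain ⟨y, -, hy⟩ := (isCompact_Icc.prod isCompact_univ :
    IsCompact (Set.Icc (0 : ℝ) 1 ×ˢ (Set.univ : Set unitInterval))).exists_isMinOn
    ⟨(0, 0), by simp⟩ hf.continuousOn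
  refine ⟨y, fun x => ?_⟩
  have hper : Function.Periodic (fun θ : ℝ => f (θ, x.2)) 1 := fun θ => hT (θ, x.2)
  obtain ⟨θ, hθ, hθ'⟩ := hper.exists_mem_Ico₀ one_pos x.1
  have hθ' : f x = f (θ, x.2) := hθ'
  rw [hθ']
  exact hy ⟨⟨hθ.1, hθ.2.le⟩, trivial⟩

/-- A map that strictly increases a continuous function, with increments invariant under `T`,
increases it by a definite amount. -/
theorem exists_gap {Φ : Band → Band} (hΦ : Continuous Φ) (hT : Function.Commute Φ T)
    {h : Band → ℝ} (hh : Continuous h) {c : ℝ} (hhT : ∀ x, h (T x) = h x + c)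
    (hlt : ∀ x, h x < h (Φ x)) : ∃ δ > 0, ∀ x, h x + δ ≤ h (Φ x) := by
  obtain ⟨y, hy⟩ := exists_forall_le_of_T_invariant (f := fun x => h (Φ x) - h x) (by fun_prop)
    (fun x => by
      have h1 : Φ (T x) = T (Φ x) := hT x
      simp only [h1, hhT]
      ring)
  exact ⟨h (Φ y) - h y, sub_pos.mpr (hlt y), fun x => by linarith [hy x]⟩

/-! ### Positive rotation sets and the increasing function -/

/-- If the rotation set is positive, some positive iterate moves every point to the right. -/
theorem exists_iterate_gt {Φ : Band → Band} (hΦ : Continuous Φ) (hT : Function.Commute Φ T)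
    (hR : rotationSet Φ ⊆ Set.Ioi 0) : ∃ N : ℕ, 0 < N ∧ ∀ x : Band, x.1 < (Φ^[N] x).1 := by
  by_contra! hcon
  choose! x hx using hcon
  obtain ⟨y, hy⟩ := exists_forall_le_of_T_invariant (f := fun x => (Φ x).1 - x.1) (by fun_prop)
    (fun x => by
      have h1 : Φ (T x) = T (Φ x) := hT x
      have h2 : ∀ z, (T z).1 = z.1 + 1 := fun _ => rfl
      simp only [h1, h2]
      ring)
  set m := (Φ y).1 - y.1
  have hlow : ∀ (n : ℕ) (z : Band), n * m ≤ (Φ^[n] z).1 - z.1 := by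
    intro n z
    induction n with
    | zero => simp
    | succ n ih =>
      rw [Function.iterate_succ_apply']
      push_cast
      linarith [hy (Φ^[n] z)]
  set v : ℕ → ℝ := fun k => ((Φ^[k + 1] (x (k + 1))).1 - (x (k + 1)).1) / ((k + 1 : ℕ) : ℝ)
  have hv : ∀ k, v k ∈ Set.Icc m 0 := by
    intro k
    have hk : (0 : ℝ) < ((k + 1 : ℕ) : ℝ) := by positivity
    refine ⟨?_, div_nonpos_of_nonpos_of_nonneg (by linarith [hx (k + 1) k.succ_pos]) hk.le⟩
    rw [le_div_iff₀ hk]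
    linarith [hlow (k + 1) (x (k + 1))]
  obtain ⟨r, hr, φ, hφ, hlim⟩ := isCompact_Icc.tendsto_subseq hv
  have hmem : r ∈ rotationSet Φ :=
    ⟨fun k => φ k + 1, v ∘ φ, (tendsto_add_atTop_nat 1).comp hφ.tendsto_atTop,
      fun k => ⟨x (φ k + 1), rfl⟩, hlim⟩
  exact absurd (hR hmem) (not_lt.mpr hr.2)

theorem birkhoffSum_T {Φ : Band → Band} (hT : Function.Commute Φ T) {u : Band → ℝ} {c : ℝ}
    (hu : ∀ x, u (T x) = u x + c) (n : ℕ) (x : Band) :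
    birkhoffSum Φ u n (T x) = birkhoffSum Φ u n x + n * c := by
  have h : ∀ k, Φ^[k] (T x) = T (Φ^[k] x) := fun k => (hT.iterate_left k) x
  simp [birkhoffSum, h, hu, Finset.sum_add_distrib]

theorem continuous_birkhoffSum {Φ : Band → Band} (hΦ : Continuous Φ) {u : Band → ℝ}
    (hu : Continuous u) (n : ℕ) : Continuous (birkhoffSum Φ u n) :=
  continuous_finsetSum _ fun k _ => hu.comp (hΦ.iterate k)

/-- Commuting maps whose rotation sets are positive admit a common function that increases along
both of them, and that behaves like a multiple of the horizontal coordinate. -/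
theorem exists_lyapunov {Φ₁ Φ₂ : Band → Band} (h₁ : Continuous Φ₁) (h₂ : Continuous Φ₂)
    (hcomm : Function.Commute Φ₁ Φ₂) (hT₁ : Function.Commute Φ₁ T) (hT₂ : Function.Commute Φ₂ T)
    (hR₁ : rotationSet Φ₁ ⊆ Set.Ioi 0) (hR₂ : rotationSet Φ₂ ⊆ Set.Ioi 0) :
    ∃ (h : Band → ℝ) (c δ : ℝ), Continuous h ∧ 0 < c ∧ (∀ x, h (T x) = h x + c) ∧ 0 < δ ∧
      (∀ x, h x + δ ≤ h (Φ₁ x)) ∧ ∀ x, h x + δ ≤ h (Φ₂ x) := by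
  obtain ⟨N, hN, hN'⟩ := exists_iterate_gt h₁ hT₁ hR₁
  obtain ⟨M, hM, hM'⟩ := exists_iterate_gt h₂ hT₂ hR₂
  set u : Band → ℝ := birkhoffSum Φ₂ Prod.fst M
  set h : Band → ℝ := birkhoffSum Φ₁ u N
  have huT : ∀ x, u (T x) = u x + M * 1 := birkhoffSum_T hT₂ (fun x => rfl) M
  have hhT : ∀ x, h (T x) = h x + N * (M * 1) := birkhoffSum_T hT₁ huT N
  have hh : Continuous h :=
    continuous_birkhoffSum h₁ (continuous_birkhoffSum h₂ continuous_fst M) N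
  have hlt₁ : ∀ x, h x < h (Φ₁ x) := by
    intro x
    rw [← sub_pos, birkhoffSum_apply_sub_birkhoffSum, sub_pos]
    refine Finset.sum_lt_sum_of_nonempty (by simpa using hM.ne') fun j _ => ?_
    have : Φ₂^[j] (Φ₁^[N] x) = Φ₁^[N] (Φ₂^[j] x) := ((hcomm.iterate_iterate N j) x).symm
    rw [this]
    exact hN' _
  have hlt₂ : ∀ x, h x < h (Φ₂ x) := by
    intro x
    refine Finset.sum_lt_sum_of_nonempty (by simpa using hN.ne') fun i _ => ?_
    have : Φ₁^[i] (Φ₂ x) = Φ₂ (Φ₁^[i] x) := (hcomm.iterate_left i) x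
    rw [this, ← sub_pos, birkhoffSum_apply_sub_birkhoffSum, sub_pos]
    exact hM' _
  obtain ⟨δ₁, hδ₁, hg₁⟩ := exists_gap h₁ hT₁ hh hhT hlt₁
  obtain ⟨δ₂, hδ₂, hg₂⟩ := exists_gap h₂ hT₂ hh hhT hlt₂
  refine ⟨h, N * (M * 1), min δ₁ δ₂, hh, by positivity, hhT, lt_min hδ₁ hδ₂, fun x => ?_,
    fun x => ?_⟩
  · linarith [hg₁ x, min_le_left δ₁ δ₂]
  · linarith [hg₂ x, min_le_right δ₁ δ₂]

/-- A continuous function that grows by `c > 0` under `T` is negative far to the left and positive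
far to the right. -/
theorem exists_sign_bounds {h : Band → ℝ} (hh : Continuous h) {c : ℝ} (hc : 0 < c)
    (hhT : ∀ x, h (T x) = h x + c) :
    ∃ a b : ℝ, (∀ x : Band, x.1 ≤ a → h x < 0) ∧ ∀ x : Band, b ≤ x.1 → 0 < h x := by
  obtain ⟨y, hy⟩ := exists_forall_le_of_T_invariant (f := fun x => h x - c * x.1) (by fun_prop)
    (fun x => by
      have h2 : (T x).1 = x.1 + 1 := rfl
      simp only [hhT, h2]
      ring)
  obtain ⟨z, hz⟩ := exists_forall_le_of_T_invariant (f := fun x => c * x.1 - h x) (by fun_prop)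
    (fun x => by
      have h2 : (T x).1 = x.1 + 1 := rfl
      simp only [hhT, h2]
      ring)
  refine ⟨(c * z.1 - h z - 1) / c, (1 - (h y - c * y.1)) / c, fun x hx => ?_, fun x hx => ?_⟩
  · rw [le_div_iff₀ hc] at hx
    linarith [hz x]
  · rw [div_le_iff₀ hc] at hx
    linarith [hy x]

/-- A set on which `|h| < δ / 2` is disjoint from its image under a map increasing `h` by at least
`δ`. -/
theorem disjoint_range_image {ι : Type*} {γ : ι → Band} {Φ : Band → Band} {h : Band → ℝ} {δ : ℝ}
    (hγ : ∀ s, |h (γ s)| < δ / 2) (hΦ : ∀ x, h x + δ ≤ h (Φ x)) :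
    Disjoint (Set.range γ) (Φ '' Set.range γ) := by
  rw [Set.disjoint_left]
  rintro _ ⟨s, rfl⟩ ⟨_, ⟨t, rfl⟩, hst⟩
  have h1 := hΦ (γ t)
  rw [hst] at h1
  have h2 := (abs_lt.mp (hγ s)).2
  have h3 := (abs_lt.mp (hγ t)).1
  linarith

end Band

theorem mainTheorem8 (Φ₁ Φ₂ : Band ≃ₜ Band)
    (hI₁ : Band.IsotopicToId Φ₁) (hI₂ : Band.IsotopicToId Φ₂)
    (hcomm : Function.Commute Φ₁ Φ₂)
    (hT₁ : Function.Commute Φ₁ Band.T) (hT₂ : Function.Commute Φ₂ Band.T)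
    (hR₁ : Band.rotationSet Φ₁ ⊆ Set.Ioi 0) (hR₂ : Band.rotationSet Φ₂ ⊆ Set.Ioi 0) :
    ∃ γ : unitInterval → Band, Band.IsEssentialSimpleArc γ ∧
      Disjoint (Set.range γ) (Φ₁ '' Set.range γ) ∧
      Disjoint (Set.range γ) (Φ₂ '' Set.range γ) := by
  obtain ⟨h, c, δ, hh, hc, hhT, hδ, hg₁, hg₂⟩ :=
    Band.exists_lyapunov Φ₁.continuous Φ₂.continuous hcomm hT₁ hT₂ hR₁ hR₂
  obtain ⟨a, b, ha, hb⟩ := Band.exists_sign_bounds hh hc hhT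
  obtain ⟨γ, hγ, hγh⟩ := Band.exists_isEssentialSimpleArc_abs_lt hh (half_pos hδ) ha hb
  exact ⟨γ, hγ, Band.disjoint_range_image hγh hg₁, Band.disjoint_range_image hγh hg₂⟩
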